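/- Fix an integer $k\ge 0$ and a real number $R>0$, and let $S^k=\{x\in\mathbb{R}^{k+1} : x\cdot x=R^2\}$. For an integer $N\ge 0$ let $\mathrm{Trig}_N(\mathbb{R}^{k+1})$ be the finite-dimensional real vector space of trigonometric polynomials $n(\theta)=v+\sum_{s=1}^{N}\bigl(a[s]\cos(s\theta)+b[s]\sin(s\theta)\bigr)$ with $v,a[s],b[s]\in\mathbb{R}^{k+1}$, regarded as continuous maps $S^1\to\mathbb{R}^{k+1}$ and given its usual topology (equivalently, that of uniform convergence), and let $$L_N(S^k)=\{n\in\mathrm{Trig}_N(\mathbb{R}^{k+1}) : n(\theta)\cdot n(\theta)=R^2\ \text{for all }\theta\in\mathbb{R}\},$$ so that $L_0(S^k)\subset L_1(S^k)\subset\cdots$. Let $V_2(\mathbb{R}^{k+1})$ be the Stiefel manifold of orthonormal $2$-frames in $\mathbb{R}^{k+1}$, that is, of real $(k+1)\times 2$ matrices $V$ with $V^{t}V=I_2$. All subsets carry the subspace topology. Then: 1. for every $N\ge 1$, the space $L_{N+1}(S^k)\setminus L_N(S^k)$ is homotopy equivalent to $L_N(S^k)\setminus L_{N-1}(S^k)$;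 2. consequently, for every $N\ge 1$, the space $L_{N+1}(S^k)\setminus L_N(S^k)$ is homotopy equivalent to $L_1(S^k)\setminus L_0(S^k)$; 3. the space $L_1(S^k)\setminus L_0(S^k)$ is homotopy equivalent to $V_2(\mathbb{R}^{k+1})$. (For $k=0$ all the spaces in 1-3 are empty.) -/

import Mathlib

open scoped ContinuousMap

/-- `Trig_N(ℝ^{k+1})`: the loops `S¹ → ℝ^{k+1}` that are trigonometric polynomials of degree at
most `N` in the angle `θ`, where `z = exp(√-1 θ)`. They are taken inside the space of continuous
loops, with the topology of uniform convergence; on this finite-dimensional linear subspace that is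
the usual topology given by the coefficients. -/
def trigLoops (k N : ℕ) : Set C(Circle, EuclideanSpace ℝ (Fin (k + 1))) :=
  {n | ∃ (v : EuclideanSpace ℝ (Fin (k + 1))) (a b : ℕ → EuclideanSpace ℝ (Fin (k + 1))),
    ∀ θ : ℝ, n (Circle.exp θ) =
      v + ∑ s ∈ Finset.Icc 1 N, (Real.cos (s * θ) • a s + Real.sin (s * θ) • b s)}

/-- `L_N(S^k)`, for the sphere `S^k` of radius `R` centred at the origin of `ℝ^{k+1}`: the
trigonometric polynomial loops of degree at most `N` that lie on the sphere. -/
def sphereLoops (k : ℕ) (R : ℝ) (N : ℕ) : Set C(Circle, EuclideanSpace ℝ (Fin (k + 1))) :=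
  {n | n ∈ trigLoops k N ∧ ∀ z : Circle, inner ℝ (n z) (n z) = R ^ 2}

/-- The Stiefel manifold `V_m(ℝ^d)` of orthonormal `m`-frames in `ℝ^d`: the real `d × m` matrices
`V` with `Vᵀ V = 1`, as a subspace of the space of matrices. -/
def stiefelManifold (m d : ℕ) : Set (Matrix (Fin d) (Fin m) ℝ) :=
  {V | V.transpose * V = 1}

/-!
A loop `n` of degree exactly `N ≥ 1` has leading Fourier coefficient `c = (a - √-1 b) / 2`, and the
coefficient of `z ^ (2 * N)` in `n ⬝ n = R ^ 2` says that `c ⬝ c = 0`: the vectors `a`, `b` form a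
conformal pair (`inner_cosCoef_sinCoef`). Let `g_c z` be the map of `ℝ^{k+1}` that rotates the plane
of `a` and `b` by `z`, so that it is multiplication by `z` on `c`, by `z⁻¹` on `c̄`, and the identity
on the orthogonal complement (`twist`).

* If `n` has degree `N + 1`, then `(g_c z)⁻¹ (n z)` has degree `N` (`lower_mem_exactLoops`). What has
  to be seen is that the component of `n` along `c̄`, which is multiplied by `z`, has degree at
  most `N - 1`. It has degree at most `N` as `c` has no component along `c̄`, and the coefficient of
  `z ^ (2 * N + 1)` in `n ⬝ n = R ^ 2` removes one more term
  (`star_planeLoop_mem_degLE_sub_one`).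
* If `m` has degree `N` and leading coefficient `d`, then `g_d z (m z)` has degree `N + 1` and again
  leading coefficient `d` (`raise_mem_exactLoops`, `cosCoef_sinCoef_raise`). Hence lowering the
  result gives back `m` (`lower_raise`).
* In the other order, let `m` be obtained by lowering `n`, with leading coefficients `d` and `c`.
  Here `d = c + w + l c̄` with `w` orthogonal to the plane. For every isotropic `e` whose Hermitian
  product with `d` is nonzero, `g_e z (m z)` has degree exactly `N + 1`. The vectors
  `c + t w + t² l c̄` form such a path from `c` to `d` (`isConformalPair_bridge`), along which
  `g_e z (m z)` runs from `n` to the loop obtained by raising `m`.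

In degree one the loops are the circles `v + cos θ a + sin θ b` with `v`, `a`, `b` orthogonal
and `a`, `b` of the same length. Moving the centre `v` to the origin deforms them to great circles,
which correspond to orthonormal frames (`stiefelEquiv`).

Degrees are handled through the complex functions `⟪n, y⟫` on the circle. As these are real-valued,
a bound on the exponents from above (`degLE`) also bounds them from below (`mem_trigLoops_iff`), and
the only fact needed on products is that leading coefficients multiply (`coef_add_mul`). Leading
coefficients are integrals over the circle, so they depend continuously on the loop.
-/

namespace SphereLoop

open MeasureTheory

/-! ### Laurent polynomials on the circle -/

/-- The monomial `z ↦ z ^ m` on the unit circle. -/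
noncomputable def mono (m : ℤ) : C(Circle, ℂ) :=
  ⟨fun z => ((z ^ m : Circle) : ℂ), continuous_subtype_val.comp (continuous_zpow m)⟩

theorem mono_apply (m : ℤ) (z : Circle) : mono m z = ((z ^ m : Circle) : ℂ) := rfl

theorem mono_mul_mono (m n : ℤ) : mono m * mono n = mono (m + n) := by
  ext z
  simp [mono_apply, zpow_add]

theorem mono_zero : mono 0 = 1 := by
  ext z
  simp [mono_apply]

/-- The mean value of a continuous function on the circle. -/
noncomputable def circleMean : C(Circle, ℂ) →L[ℂ] ℂ :=
  LinearMap.mkContinuous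
    { toFun := fun f => ∫ t : AddCircle (1 : ℝ), f t.toCircle ∂AddCircle.haarAddCircle
      map_add' := fun f g => integral_add
        ((f.comp ⟨_, AddCircle.continuous_toCircle⟩).continuous.integrable_of_hasCompactSupport
          (HasCompactSupport.of_compactSpace _))
        ((g.comp ⟨_, AddCircle.continuous_toCircle⟩).continuous.integrable_of_hasCompactSupport
          (HasCompactSupport.of_compactSpace _))
      map_smul' := fun c f => integral_const_mul c _ } 1 (by
    intro f
    refine (norm_integral_le_of_norm_le_const (C := ‖f‖)
      (Filter.Eventually.of_forall fun t => f.norm_coe_le_norm _)).trans ?_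
    simp)

theorem circleMean_apply (f : C(Circle, ℂ)) :
    circleMean f = ∫ t : AddCircle (1 : ℝ), f t.toCircle ∂AddCircle.haarAddCircle := rfl

theorem circleMean_mono (m : ℤ) : circleMean (mono m) = if m = 0 then 1 else 0 := by
  split_ifs with hm
  · subst hm
    simp [circleMean_apply, mono_zero]
  · have h (t : AddCircle (1 : ℝ)) : mono m t.toCircle = fourier m t := by
      rw [mono_apply, fourier_apply, AddCircle.toCircle_zsmul]
    simp_rw [circleMean_apply, h]
    exact integral_eq_zero_of_add_right_eq_neg (fourier_add_half_inv_index hm one_pos)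

/-- The `s`-th Fourier coefficient of a continuous function on the circle, as a continuous linear
functional. -/
noncomputable def coef (s : ℤ) : C(Circle, ℂ) →L[ℂ] ℂ :=
  circleMean ∘L ContinuousLinearMap.mul ℂ C(Circle, ℂ) (mono (-s))

theorem coef_apply (s : ℤ) (f : C(Circle, ℂ)) : coef s f = circleMean (mono (-s) * f) := rfl

theorem coef_mono (s m : ℤ) : coef s (mono m) = if m = s then 1 else 0 := by
  rw [coef_apply, mono_mul_mono, circleMean_mono]
  simp only [neg_add_eq_zero, eq_comm]

theorem coef_mono_mul (s m : ℤ) (f : C(Circle, ℂ)) : coef s (mono m * f) = coef (s - m) f := by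
  rw [coef_apply, coef_apply, ← mul_assoc, mono_mul_mono, neg_sub, neg_add_eq_sub]

theorem coef_conj (s : ℤ) (f : C(Circle, ℂ)) : coef (-s) (star f) = star (coef s f) := by
  rw [coef_apply, coef_apply, circleMean_apply, circleMean_apply]
  refine Eq.trans ?_ integral_conj
  congr 1
  ext t
  simp [mono_apply, ← Circle.coe_inv_eq_conj]

/-- The Laurent polynomials of degree at most `p` on the circle, with no bound on the order of the
pole at `0`. -/
noncomputable def degLE (p : ℤ) : Submodule ℂ C(Circle, ℂ) :=
  Submodule.span ℂ (mono '' Set.Iic p)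

theorem mono_mem_degLE {m p : ℤ} (h : m ≤ p) : mono m ∈ degLE p :=
  Submodule.subset_span ⟨m, h, rfl⟩

theorem degLE_mono {p q : ℤ} (h : p ≤ q) : degLE p ≤ degLE q :=
  Submodule.span_mono (Set.image_mono (Set.Iic_subset_Iic.2 h))

theorem coef_eq_zero_of_mem_degLE {p s : ℤ} {f : C(Circle, ℂ)} (hf : f ∈ degLE p) (h : p < s) :
    coef s f = 0 := by
  induction hf using Submodule.span_induction with
  | mem x hx =>
    obtain ⟨m, hm, rfl⟩ := hx
    rw [coef_mono, if_neg]
    have := Set.mem_Iic.1 hm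
    omega
  | zero => simp
  | add x y _ _ hx hy => rw [map_add, hx, hy, add_zero]
  | smul c x _ hx => rw [map_smul, hx, smul_zero]

theorem mul_mem_degLE {p q : ℤ} {f g : C(Circle, ℂ)} (hf : f ∈ degLE p) (hg : g ∈ degLE q) :
    f * g ∈ degLE (p + q) := by
  have h : degLE p * degLE q ≤ degLE (p + q) := by
    rw [degLE, degLE, Submodule.span_mul_span, Submodule.span_le]
    rintro _ ⟨_, ⟨m, hm, rfl⟩, _, ⟨n, hn, rfl⟩, rfl⟩
    change mono m * mono n ∈ _
    rw [mono_mul_mono]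
    exact mono_mem_degLE (add_le_add hm hn)
  exact h (Submodule.mul_mem_mul hf hg)

theorem mono_mul_mem_degLE {p : ℤ} (m : ℤ) {f : C(Circle, ℂ)} (hf : f ∈ degLE p) :
    mono m * f ∈ degLE (m + p) :=
  mul_mem_degLE (mono_mem_degLE le_rfl) hf

/-- The leading coefficient of a product is the product of the leading coefficients. -/
theorem coef_add_mul {p q : ℤ} {f g : C(Circle, ℂ)} (hf : f ∈ degLE p) (hg : g ∈ degLE q) :
    coef (p + q) (f * g) = coef p f * coef q g := by
  induction hf using Submodule.span_induction with
  | mem x hx =>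
    obtain ⟨m, hm, rfl⟩ := hx
    rw [coef_mono_mul, coef_mono]
    split_ifs with h
    · rw [h, add_sub_cancel_left, one_mul]
    · have := Set.mem_Iic.1 hm
      rw [coef_eq_zero_of_mem_degLE hg (by omega), zero_mul]
  | zero => simp
  | add x y _ _ hx hy => rw [add_mul, map_add, hx, hy, map_add, add_mul]
  | smul c x _ hx => rw [smul_mul_assoc, map_smul, hx, map_smul, smul_eq_mul, smul_eq_mul, mul_assoc]

theorem mem_degLE_sub_one {p : ℤ} {f : C(Circle, ℂ)} (hf : f ∈ degLE p) (h : coef p f = 0) :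
    f ∈ degLE (p - 1) := by
  have key : f - coef p f • mono p ∈ degLE (p - 1) := by
    clear h
    induction hf using Submodule.span_induction with
    | mem x hx =>
      obtain ⟨m, hm, rfl⟩ := hx
      rw [coef_mono]
      split_ifs with h
      · simp [h]
      · have := Set.mem_Iic.1 hm
        simpa using mono_mem_degLE (by omega)
    | zero => simp
    | add x y _ _ hx hy =>
      convert add_mem hx hy using 1
      rw [map_add]
      module
    | smul c x _ hx =>
      convert Submodule.smul_mem _ c hx using 1
      rw [map_smul]
      module
  simpa [h] using key

/-- A Laurent polynomial is the sum of its Fourier series, over any large enough finite set of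
exponents. -/
theorem exists_eq_sum_coef {p : ℤ} {f : C(Circle, ℂ)} (hf : f ∈ degLE p) :
    ∃ S : Finset ℤ, ∀ T, S ⊆ T → f = ∑ m ∈ T, coef m f • mono m := by
  induction hf using Submodule.span_induction with
  | mem x hx =>
    obtain ⟨m, -, rfl⟩ := hx
    refine ⟨{m}, fun T hT => ?_⟩
    simp [coef_mono, Finset.singleton_subset_iff.1 hT]
  | zero => exact ⟨∅, by simp⟩
  | add x y _ _ hx hy =>
    obtain ⟨S, hS⟩ := hx
    obtain ⟨S', hS'⟩ := hy
    refine ⟨S ∪ S', fun T hT => ?_⟩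
    simp only [map_add, add_smul, Finset.sum_add_distrib]
    rw [← hS T (Finset.union_subset_left hT), ← hS' T (Finset.union_subset_right hT)]
  | smul c x _ hx =>
    obtain ⟨S, hS⟩ := hx
    refine ⟨S, fun T hT => ?_⟩
    simp only [map_smul, smul_assoc, ← Finset.smul_sum]
    rw [← hS T hT]

theorem sum_Icc_neg {M : Type*} [AddCommMonoid M] (N : ℕ) (g : ℤ → M) :
    ∑ m ∈ Finset.Icc (-N : ℤ) N, g m = g 0 + ∑ s ∈ Finset.Icc 1 N, (g s + g (-s)) := by
  induction N with
  | zero => simp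
  | succ N ih =>
    have h : Finset.Icc (-(N + 1 : ℕ) : ℤ) (N + 1 : ℕ) =
        insert ((N + 1 : ℕ) : ℤ) (insert (-((N + 1 : ℕ) : ℤ)) (Finset.Icc (-N : ℤ) N)) := by
      ext m
      simp only [Finset.mem_Icc, Finset.mem_insert]
      omega
    rw [h, Finset.sum_insert (by simp; omega), Finset.sum_insert (by simp), ih,
      Finset.sum_Icc_succ_top (by omega)]
    abel

/-- A real-valued Laurent polynomial of degree at most `N` has poles of order at most `N`, because
its coefficients of index `s` and `-s` are conjugate. -/
theorem eq_sum_of_star_eq {N : ℕ} {f : C(Circle, ℂ)} (hf : f ∈ degLE N) (hr : star f = f) :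
    f = coef 0 f • mono 0 +
      ∑ s ∈ Finset.Icc 1 N, (coef s f • mono s + star (coef s f) • mono (-s)) := by
  have hneg (s : ℤ) : coef (-s) f = star (coef s f) := by rw [← coef_conj, hr]
  obtain ⟨S, hS⟩ := exists_eq_sum_coef hf
  simp_rw [← hneg]
  rw [← sum_Icc_neg N fun m => coef m f • mono m]
  refine (hS _ Finset.subset_union_left).trans
    (Finset.sum_subset Finset.subset_union_right fun m _ hm => ?_).symm
  rw [Finset.mem_Icc, not_and_or, not_le, not_le] at hm
  rcases hm with hm | hm
  · rw [← neg_neg m, hneg, coef_eq_zero_of_mem_degLE hf (by omega), star_zero, zero_smul]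
  · rw [coef_eq_zero_of_mem_degLE hf hm, zero_smul]

/-! ### Trigonometric loops and their Fourier coefficients -/

section Coefficients

variable {ι : Type*} [Fintype ι]

/-- The component `⟪n, y⟫` of a loop `n` in the direction `y`, as a complex-valued function. -/
noncomputable def coord (n : C(Circle, EuclideanSpace ℝ ι)) (y : EuclideanSpace ℝ ι) :
    C(Circle, ℂ) :=
  (⟨fun x => ((inner ℝ x y : ℝ) : ℂ), by fun_prop⟩ : C(EuclideanSpace ℝ ι, ℂ)).comp n

theorem coord_apply (n : C(Circle, EuclideanSpace ℝ ι)) (y : EuclideanSpace ℝ ι) (z : Circle) :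
    coord n y z = ((inner ℝ (n z) y : ℝ) : ℂ) := rfl

theorem continuous_coord (y : EuclideanSpace ℝ ι) :
    Continuous fun n : C(Circle, EuclideanSpace ℝ ι) => coord n y :=
  ContinuousMap.continuous_postcomp _

theorem star_coord (n : C(Circle, EuclideanSpace ℝ ι)) (y : EuclideanSpace ℝ ι) :
    star (coord n y) = coord n y := by
  ext z
  simp [coord_apply]

variable [DecidableEq ι]

theorem coord_eq_sum (n : C(Circle, EuclideanSpace ℝ ι)) (y : EuclideanSpace ℝ ι) :
    coord n y = ∑ i, (y i : ℂ) • coord n (EuclideanSpace.single i 1) := by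
  ext z
  simp [coord_apply, PiLp.inner_apply, ContinuousMap.sum_apply]

/-- The coefficient vector of `cos (s θ)` in the Fourier series of `n`, for `s ≠ 0`; for `s = 0`
it is twice the mean of `n`. -/
noncomputable def cosCoef (s : ℤ) (n : C(Circle, EuclideanSpace ℝ ι)) : EuclideanSpace ℝ ι :=
  WithLp.toLp 2 fun i => 2 * (coef s (coord n (EuclideanSpace.single i 1))).re

/-- The coefficient vector of `sin (s θ)` in the Fourier series of `n`. -/
noncomputable def sinCoef (s : ℤ) (n : C(Circle, EuclideanSpace ℝ ι)) : EuclideanSpace ℝ ι :=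
  WithLp.toLp 2 fun i => -2 * (coef s (coord n (EuclideanSpace.single i 1))).im

theorem inner_cosCoef (s : ℤ) (n : C(Circle, EuclideanSpace ℝ ι)) (y : EuclideanSpace ℝ ι) :
    inner ℝ (cosCoef s n) y = 2 * (coef s (coord n y)).re := by
  rw [coord_eq_sum, map_sum, Complex.re_sum, Finset.mul_sum, PiLp.inner_apply]
  refine Finset.sum_congr rfl fun i _ => ?_
  simp [cosCoef]
  ring

theorem inner_sinCoef (s : ℤ) (n : C(Circle, EuclideanSpace ℝ ι)) (y : EuclideanSpace ℝ ι) :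
    inner ℝ (sinCoef s n) y = -2 * (coef s (coord n y)).im := by
  rw [coord_eq_sum, map_sum, Complex.im_sum, Finset.mul_sum, PiLp.inner_apply]
  refine Finset.sum_congr rfl fun i _ => ?_
  simp [sinCoef]
  ring

theorem coef_coord (s : ℤ) (n : C(Circle, EuclideanSpace ℝ ι)) (y : EuclideanSpace ℝ ι) :
    coef s (coord n y) =
      ((inner ℝ (cosCoef s n) y : ℝ) - (inner ℝ (sinCoef s n) y : ℝ) * Complex.I) / 2 := by
  rw [inner_cosCoef, inner_sinCoef]
  apply Complex.ext <;> simp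

theorem continuous_cosCoef (s : ℤ) :
    Continuous (cosCoef s : C(Circle, EuclideanSpace ℝ ι) → EuclideanSpace ℝ ι) := by
  refine (PiLp.continuous_toLp 2 _).comp (continuous_pi fun i => ?_)
  exact continuous_const.mul
    (Complex.continuous_re.comp ((coef s).continuous.comp (continuous_coord _)))

theorem continuous_sinCoef (s : ℤ) :
    Continuous (sinCoef s : C(Circle, EuclideanSpace ℝ ι) → EuclideanSpace ℝ ι) := by
  refine (PiLp.continuous_toLp 2 _).comp (continuous_pi fun i => ?_)
  exact continuous_const.mul
    (Complex.continuous_im.comp ((coef s).continuous.comp (continuous_coord _)))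

/-- The coefficient vectors at `s` are determined by the components of the loop. -/
theorem cosCoef_sinCoef_eq_of_coef_coord {s : ℤ} {n : C(Circle, EuclideanSpace ℝ ι)}
    {a b : EuclideanSpace ℝ ι}
    (h : ∀ y, coef s (coord n y) = ((inner ℝ a y : ℝ) - (inner ℝ b y : ℝ) * Complex.I) / 2) :
    cosCoef s n = a ∧ sinCoef s n = b := by
  refine ⟨ext_inner_right ℝ fun y => ?_, ext_inner_right ℝ fun y => ?_⟩
  · rw [inner_cosCoef, h]
    simp
    ring
  · rw [inner_sinCoef, h]
    simp
    ring

end Coefficients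

theorem mono_natCast_exp (s : ℕ) (θ : ℝ) :
    mono s (Circle.exp θ) = Real.cos (s * θ) + Real.sin (s * θ) * Complex.I := by
  rw [mono_apply, zpow_natCast, Circle.coe_pow, Circle.coe_exp, ← Complex.exp_nat_mul,
    Complex.ofReal_cos, Complex.ofReal_sin, ← Complex.exp_mul_I]
  push_cast
  ring_nf

theorem mono_neg_natCast_exp (s : ℕ) (θ : ℝ) :
    mono (-s) (Circle.exp θ) = Real.cos (s * θ) - Real.sin (s * θ) * Complex.I := by
  have h : mono (-s) (Circle.exp θ) = star (mono s (Circle.exp θ)) := by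
    rw [mono_apply, mono_apply, zpow_neg, Circle.coe_inv_eq_conj]
    rfl
  rw [h, mono_natCast_exp]
  simp [sub_eq_add_neg, -Complex.ofReal_cos, -Complex.ofReal_sin]

/-- Since loops are real-valued, membership in `trigLoops` can be read off from the Fourier
coefficients of positive index. -/
theorem mem_trigLoops_iff {k N : ℕ} {n : C(Circle, EuclideanSpace ℝ (Fin (k + 1)))} :
    n ∈ trigLoops k N ↔ ∀ y, coord n y ∈ degLE N := by
  constructor
  · rintro ⟨v, a, b, h⟩ y
    have key : coord n y = ((inner ℝ v y : ℝ) : ℂ) • mono 0 + ∑ s ∈ Finset.Icc 1 N,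
        ((((inner ℝ (a s) y : ℝ) - (inner ℝ (b s) y : ℝ) * Complex.I) / 2) • mono s +
         (((inner ℝ (a s) y : ℝ) + (inner ℝ (b s) y : ℝ) * Complex.I) / 2) • mono (-s)) := by
      ext z
      obtain ⟨θ, rfl⟩ := Circle.exp_surjective z
      rw [coord_apply, h, inner_add_left, sum_inner]
      simp only [ContinuousMap.add_apply, ContinuousMap.sum_apply, ContinuousMap.smul_apply,
        mono_natCast_exp, mono_neg_natCast_exp, mono_zero, ContinuousMap.one_apply, smul_eq_mul,
        mul_one, inner_add_left, real_inner_smul_left]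
      push_cast
      congr 1
      refine Finset.sum_congr rfl fun s _ => ?_
      linear_combination (((inner ℝ (b s) y : ℝ) : ℂ) * Complex.sin (s * θ)) * Complex.I_sq
    rw [key]
    refine add_mem (Submodule.smul_mem _ _ (mono_mem_degLE (by positivity)))
      (sum_mem fun s hs => ?_)
    have := Finset.mem_Icc.1 hs
    exact add_mem (Submodule.smul_mem _ _ (mono_mem_degLE (by omega)))
      (Submodule.smul_mem _ _ (mono_mem_degLE (by omega)))
  · intro h
    refine ⟨(1 / 2 : ℝ) • cosCoef 0 n, fun s => cosCoef s n, fun s => sinCoef s n, fun θ => ?_⟩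
    refine ext_inner_right ℝ fun y => ?_
    have key := congrArg (fun f : C(Circle, ℂ) => (f (Circle.exp θ)).re)
      (eq_sum_of_star_eq (h y) (star_coord n y))
    simp only [ContinuousMap.add_apply, ContinuousMap.sum_apply, ContinuousMap.smul_apply,
        mono_natCast_exp, mono_neg_natCast_exp, mono_zero, ContinuousMap.one_apply, smul_eq_mul,
        mul_one, coord_apply, Complex.ofReal_re, Complex.add_re, Complex.re_sum] at key
    rw [key, inner_add_left, sum_inner, real_inner_smul_left, inner_cosCoef]
    congr 1
    · ring
    refine Finset.sum_congr rfl fun s _ => ?_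
    rw [inner_add_left, real_inner_smul_left, real_inner_smul_left, inner_cosCoef, inner_sinCoef]
    simp [-Complex.ofReal_cos, -Complex.ofReal_sin]
    ring

/-! ### Conformal pairs and twists of the plane they span -/

section Twist

variable {V : Type*} [NormedAddCommGroup V] [InnerProductSpace ℝ V]

/-- Two nonzero orthogonal vectors of the same length; equivalently, `a - √-1 b` is a nonzero
isotropic vector of the complexification. -/
structure IsConformalPair (a b : V) : Prop where
  inner_self_eq : inner ℝ a a = (inner ℝ b b : ℝ)
  inner_eq_zero : inner ℝ a b = (0 : ℝ)
  ne_zero : a ≠ 0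

theorem IsConformalPair.inner_self_pos {a b : V} (h : IsConformalPair a b) :
    (0 : ℝ) < inner ℝ a a :=
  real_inner_self_pos.2 h.ne_zero

/-- The components of `x` along `a` and `b`, as one complex number. -/
def planeCoord (a b x : V) : ℂ := ⟨inner ℝ a x, inner ℝ b x⟩

/-- For a conformal pair `a`, `b`, the vector of the plane they span with `planeCoord` equal
to `w`. -/
noncomputable def planeVec (a b : V) (w : ℂ) : V :=
  (inner ℝ a a : ℝ)⁻¹ • (w.re • a + w.im • b)

/-- For a conformal pair `a`, `b`, the linear map that multiplies by the complex number `w` on the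
plane spanned by `a` and `b` (with `b` in the role of `√-1 a`) and is the identity on the orthogonal
complement. It is a rotation when `w` is on the unit circle, and for `w = 0` it is the orthogonal
projection to the complement. -/
noncomputable def twist (a b : V) (w : ℂ) (x : V) : V :=
  x + planeVec a b ((w - 1) * planeCoord a b x)

theorem planeVec_add (a b : V) (w w' : ℂ) :
    planeVec a b (w + w') = planeVec a b w + planeVec a b w' := by
  simp only [planeVec, Complex.add_re, Complex.add_im]
  module

theorem planeCoord_add (a b x y : V) :
    planeCoord a b (x + y) = planeCoord a b x + planeCoord a b y := by
  apply Complex.ext <;> simp [planeCoord, inner_add_right]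

theorem twist_one (a b x : V) : twist a b 1 x = x := by
  simp [twist, planeVec]

theorem inner_planeVec (a b x : V) (w : ℂ) :
    inner ℝ (planeVec a b w) x =
      (inner ℝ a a : ℝ)⁻¹ * (w.re * inner ℝ a x + w.im * inner ℝ b x) := by
  simp only [planeVec, real_inner_smul_left, inner_add_left]

variable {a b : V} (h : IsConformalPair a b)
include h

theorem planeCoord_planeVec (w : ℂ) : planeCoord a b (planeVec a b w) = w := by
  have hq := h.inner_self_pos.ne'
  apply Complex.ext
  · rw [planeCoord, real_inner_comm, inner_planeVec, real_inner_comm a b, h.inner_eq_zero]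
    field_simp
    ring
  · change inner ℝ b _ = _
    rw [real_inner_comm, inner_planeVec, h.inner_eq_zero, ← h.inner_self_eq]
    field_simp
    ring

theorem planeCoord_twist (w : ℂ) (x : V) :
    planeCoord a b (twist a b w x) = w * planeCoord a b x := by
  rw [twist, planeCoord_add, planeCoord_planeVec h]
  ring

theorem twist_twist (w w' : ℂ) (x : V) : twist a b w (twist a b w' x) = twist a b (w * w') x := by
  rw [twist, planeCoord_twist h, twist, twist, add_assoc, ← planeVec_add]
  congr 2
  ring

theorem inner_twist_self (w : ℂ) (x : V) :
    inner ℝ (twist a b w x) (twist a b w x) = inner ℝ x x +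
      (inner ℝ a a : ℝ)⁻¹ * ((Complex.normSq w - 1) * Complex.normSq (planeCoord a b x)) := by
  have e (v : ℂ) : inner ℝ (planeVec a b v) (planeVec a b v) =
      (inner ℝ a a : ℝ)⁻¹ * (v.re * v.re + v.im * v.im) := by
    have e1 := congrArg Complex.re (planeCoord_planeVec h v)
    have e2 := congrArg Complex.im (planeCoord_planeVec h v)
    simp only [planeCoord] at e1 e2
    rw [inner_planeVec, e1, e2]
  rw [twist, real_inner_add_add_self, real_inner_comm (planeVec a b _) x, e, inner_planeVec]
  simp only [planeCoord, Complex.normSq_apply, Complex.mul_re, Complex.mul_im, Complex.sub_re,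
    Complex.sub_im, Complex.one_re, Complex.one_im]
  ring

end Twist

theorem continuous_twist {V X : Type*} [NormedAddCommGroup V] [InnerProductSpace ℝ V]
    [TopologicalSpace X] {a b x : X → V} {w : X → ℂ} (ha : Continuous a) (hb : Continuous b)
    (hw : Continuous w) (hx : Continuous x)
    (hq : Continuous fun p => (inner ℝ (a p) (a p) : ℝ)⁻¹) :
    Continuous fun p => twist (a p) (b p) (w p) (x p) := by
  have hu : Continuous fun p => planeCoord (a p) (b p) (x p) := by
    have : (fun p => planeCoord (a p) (b p) (x p)) = fun p =>
        ((inner ℝ (a p) (x p) : ℝ) : ℂ) + ((inner ℝ (b p) (x p) : ℝ) : ℂ) * Complex.I := by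
      funext p
      apply Complex.ext <;> simp [planeCoord]
    rw [this]
    fun_prop
  have hv : Continuous fun p => (w p - 1) * planeCoord (a p) (b p) (x p) := by fun_prop
  exact hx.add (hq.smul (((Complex.continuous_re.comp hv).smul ha).add
    ((Complex.continuous_im.comp hv).smul hb)))

/-! ### A path between conformal pairs -/

section Path

variable {V : Type*} [NormedAddCommGroup V] [InnerProductSpace ℝ V]

/-- A path from `c` to `d`, for `c` in the plane spanned by `a` and `b`: the component of `d - c`
orthogonal to the plane is scaled by `t`, the component in the plane by `t ^ 2`. -/
noncomputable def bridge (a b c d : V) (t : ℝ) : V :=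
  c + t • twist a b 0 d + t ^ 2 • (d - twist a b 0 d - c)

theorem bridge_zero (a b c d : V) : bridge a b c d 0 = c := by simp [bridge]

theorem bridge_one (a b c d : V) : bridge a b c d 1 = d := by
  rw [bridge]
  module

/-- In the complexification, put `γ = a - √-1 b` and `δ = c - √-1 d`. The hypotheses say that both
are isotropic and that `δ = γ + ω + μ γ̄` with `ω` orthogonal to `γ` and `γ̄`. The path is then
`γ + t ω + t² μ γ̄`: the weights make it isotropic, and its Hermitian product with `δ` is a sum of
nonnegative terms the first of which is the squared length of `γ`. -/
theorem isConformalPair_bridge {a b c d : V} (h : IsConformalPair a b)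
    (hcd : inner ℝ c c = (inner ℝ d d : ℝ)) (hcd' : inner ℝ c d = (0 : ℝ))
    (h1 : inner ℝ c a + inner ℝ d b = 2 * (inner ℝ a a : ℝ))
    (h2 : inner ℝ c b = (inner ℝ d a : ℝ)) {t : ℝ} (ht : 0 ≤ t) :
    IsConformalPair (bridge a b a c t) (bridge a b b d t) ∧
      (0 : ℝ) < inner ℝ c (bridge a b a c t) + inner ℝ d (bridge a b b d t) := by
  have hq := h.inner_self_pos
  set q : ℝ := inner ℝ a a with hqdef
  have hbb : inner ℝ b b = q := h.inner_self_eq.symm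
  have hab : inner ℝ a b = (0 : ℝ) := h.inner_eq_zero
  have hba : inner ℝ b a = (0 : ℝ) := by rw [real_inner_comm, hab]
  -- the coefficient `μ` of `γ̄` in `δ` is `l - √-1 r`
  obtain ⟨l, hl⟩ : ∃ l : ℝ, inner ℝ a c = (1 + l) * q := ⟨inner ℝ a c / q - 1, by field_simp; ring⟩
  obtain ⟨r, hr⟩ : ∃ r : ℝ, inner ℝ b c = r * q := ⟨inner ℝ b c / q, by field_simp⟩
  have hl' : inner ℝ b d = (1 - l) * q := by
    rw [real_inner_comm, hl] at h1
    rw [real_inner_comm]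
    linarith
  have hr' : inner ℝ a d = r * q := by rw [real_inner_comm, ← h2, real_inner_comm, hr]
  obtain ⟨w, hw⟩ : ∃ w, w = twist a b 0 c := ⟨_, rfl⟩
  obtain ⟨w', hw'⟩ : ∃ w', w' = twist a b 0 d := ⟨_, rfl⟩
  have hc : c = (1 + l) • a + r • b + w := by
    rw [hw, twist, planeVec, planeCoord, hl, hr, ← hqdef]
    simp only [zero_sub, neg_mul, one_mul, Complex.neg_re, Complex.neg_im, smul_add, smul_smul]
    rw [show q⁻¹ * -((1 + l) * q) = -(1 + l) by field_simp, show q⁻¹ * -(r * q) = -r by field_simp]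
    module
  have hd : d = r • a + (1 - l) • b + w' := by
    rw [hw', twist, planeVec, planeCoord, hl', hr', ← hqdef]
    simp only [zero_sub, neg_mul, one_mul, Complex.neg_re, Complex.neg_im, smul_add, smul_smul]
    rw [show q⁻¹ * -((1 - l) * q) = -(1 - l) by field_simp, show q⁻¹ * -(r * q) = -r by field_simp]
    module
  have haw : inner ℝ a w = (0 : ℝ) := by
    have := hl
    rw [hc] at this
    simp only [inner_add_right, real_inner_smul_right, hab, ← hqdef] at this
    linarith
  have hbw : inner ℝ b w = (0 : ℝ) := by
    have := hr
    rw [hc] at this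
    simp only [inner_add_right, real_inner_smul_right, hba, hbb] at this
    linarith
  have haw' : inner ℝ a w' = (0 : ℝ) := by
    have := hr'
    rw [hd] at this
    simp only [inner_add_right, real_inner_smul_right, hab, ← hqdef] at this
    linarith
  have hbw' : inner ℝ b w' = (0 : ℝ) := by
    have := hl'
    rw [hd] at this
    simp only [inner_add_right, real_inner_smul_right, hba, hbb] at this
    linarith
  have hwa : inner ℝ w a = (0 : ℝ) := by rw [real_inner_comm, haw]
  have hwb : inner ℝ w b = (0 : ℝ) := by rw [real_inner_comm, hbw]
  have hwa' : inner ℝ w' a = (0 : ℝ) := by rw [real_inner_comm, haw']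
  have hwb' : inner ℝ w' b = (0 : ℝ) := by rw [real_inner_comm, hbw']
  have e1 : bridge a b a c t = (1 + t ^ 2 * l) • a + (t ^ 2 * r) • b + t • w := by
    rw [bridge, ← hw, hc]
    module
  have e2 : bridge a b b d t = (t ^ 2 * r) • a + (1 - t ^ 2 * l) • b + t • w' := by
    rw [bridge, ← hw', hd]
    module
  generalize bridge a b a c t = A at e1 ⊢
  generalize bridge a b b d t = B at e2 ⊢
  have hww : (0 : ℝ) ≤ inner ℝ w w := real_inner_self_nonneg
  have hww' : (0 : ℝ) ≤ inner ℝ w' w' := real_inner_self_nonneg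
  have hpos : (0 : ℝ) < inner ℝ c A + inner ℝ d B := by
    have : 0 < 2 * q + 2 * (t * l) ^ 2 * q + 2 * (t * r) ^ 2 * q +
        t * (inner ℝ w w + inner ℝ w' w') := by positivity
    rw [e1, e2, hc, hd]
    simp only [inner_add_left, inner_add_right, real_inner_smul_left, real_inner_smul_right, hab,
      hba, hbb, ← hqdef, haw, hbw, haw', hbw', hwa, hwb, hwa', hwb']
    linarith
  rw [hc, hd] at hcd hcd'
  simp only [inner_add_left, inner_add_right, real_inner_smul_left, real_inner_smul_right, hab, hba,
    hbb, ← hqdef, haw, hbw, haw', hbw', hwa, hwb, hwa', hwb'] at hcd hcd'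
  have hAB : inner ℝ A A = (inner ℝ B B : ℝ) := by
    rw [e1, e2]
    simp only [inner_add_left, inner_add_right, real_inner_smul_left, real_inner_smul_right, hab,
      hba, hbb, ← hqdef, haw, hbw, haw', hbw', hwa, hwb, hwa', hwb']
    linear_combination t ^ 2 * hcd
  have hAB' : inner ℝ A B = (0 : ℝ) := by
    rw [e1, e2]
    simp only [inner_add_left, inner_add_right, real_inner_smul_left, real_inner_smul_right, hab,
      hba, hbb, ← hqdef, haw', hbw', hwa, hwb]
    linear_combination t ^ 2 * hcd'
  refine ⟨⟨hAB, hAB', fun hA => ?_⟩, hpos⟩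
  have hB : B = 0 := by
    rw [hA, inner_zero_left] at hAB
    exact inner_self_eq_zero.1 hAB.symm
  simp [hA, hB] at hpos

end Path

/-! ### Twisting loops -/

section TwistLoop

variable {ι : Type*} [Fintype ι]

/-- The loop `z ↦ planeCoord a b (n z)`. -/
noncomputable def planeLoop (a b : EuclideanSpace ℝ ι) (n : C(Circle, EuclideanSpace ℝ ι)) :
    C(Circle, ℂ) :=
  coord n a + Complex.I • coord n b

theorem planeLoop_apply (a b : EuclideanSpace ℝ ι) (n : C(Circle, EuclideanSpace ℝ ι))
    (z : Circle) : planeLoop a b n z = planeCoord a b (n z) := by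
  apply Complex.ext <;> simp [planeLoop, coord_apply, planeCoord, real_inner_comm]

theorem star_planeLoop (a b : EuclideanSpace ℝ ι) (n : C(Circle, EuclideanSpace ℝ ι)) :
    star (planeLoop a b n) = coord n a - Complex.I • coord n b := by
  ext z
  simp [planeLoop, coord_apply, sub_eq_add_neg]

/-- The loop obtained from `n` by applying to `n z` the twist by `g z`. -/
noncomputable def twistLoop (a b : EuclideanSpace ℝ ι) (g : C(Circle, ℂ))
    (n : C(Circle, EuclideanSpace ℝ ι)) : C(Circle, EuclideanSpace ℝ ι) :=
  ⟨fun z => twist a b (g z) (n z), continuous_twist continuous_const continuous_const g.continuous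
    n.continuous continuous_const⟩

theorem twistLoop_apply (a b : EuclideanSpace ℝ ι) (g : C(Circle, ℂ))
    (n : C(Circle, EuclideanSpace ℝ ι)) (z : Circle) :
    twistLoop a b g n z = twist a b (g z) (n z) := rfl

theorem planeLoop_twistLoop {a b : EuclideanSpace ℝ ι} (h : IsConformalPair a b) (g : C(Circle, ℂ))
    (n : C(Circle, EuclideanSpace ℝ ι)) :
    planeLoop a b (twistLoop a b g n) = g * planeLoop a b n := by
  ext z
  rw [planeLoop_apply, twistLoop_apply, planeCoord_twist h, ContinuousMap.mul_apply,
    planeLoop_apply]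

theorem twistLoop_twistLoop {a b : EuclideanSpace ℝ ι} (h : IsConformalPair a b)
    (g g' : C(Circle, ℂ)) (n : C(Circle, EuclideanSpace ℝ ι)) :
    twistLoop a b g (twistLoop a b g' n) = twistLoop a b (g * g') n := by
  ext1 z
  exact twist_twist h _ _ _

theorem twistLoop_one (a b : EuclideanSpace ℝ ι) (n : C(Circle, EuclideanSpace ℝ ι)) :
    twistLoop a b 1 n = n := by
  ext1 z
  exact twist_one _ _ _

theorem coord_twistLoop (a b : EuclideanSpace ℝ ι) (g : C(Circle, ℂ))
    (n : C(Circle, EuclideanSpace ℝ ι)) (y : EuclideanSpace ℝ ι) :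
    coord (twistLoop a b g n) y = coord n y +
      (star (planeCoord a b y) / (2 * (inner ℝ a a : ℝ))) •
        (g * planeLoop a b n - planeLoop a b n) +
      (planeCoord a b y / (2 * (inner ℝ a a : ℝ))) •
        (star g * star (planeLoop a b n) - star (planeLoop a b n)) := by
  ext z
  have key (v : ℂ) (r s : ℝ) : ((v.re * r + v.im * s : ℝ) : ℂ) =
      (v * star (⟨r, s⟩ : ℂ) + star v * ⟨r, s⟩) / 2 := by
    apply Complex.ext <;> simp
    ring
  rw [coord_apply, twistLoop_apply, twist, inner_add_left, inner_planeVec, Complex.ofReal_add,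
    Complex.ofReal_mul, key, ← planeLoop_apply]
  simp only [ContinuousMap.add_apply, ContinuousMap.sub_apply, ContinuousMap.mul_apply,
    ContinuousMap.smul_apply, ContinuousMap.star_apply, coord_apply, smul_eq_mul, star_mul',
    star_sub, star_one, Complex.ofReal_inv, div_eq_mul_inv, mul_inv, planeCoord]
  ring

variable {N : ℤ} {n : C(Circle, EuclideanSpace ℝ ι)}

theorem planeLoop_mem_degLE (a b : EuclideanSpace ℝ ι) (hn : ∀ y, coord n y ∈ degLE N) :
    planeLoop a b n ∈ degLE N :=
  add_mem (hn a) (Submodule.smul_mem _ _ (hn b))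

theorem star_planeLoop_mem_degLE (a b : EuclideanSpace ℝ ι) (hn : ∀ y, coord n y ∈ degLE N) :
    star (planeLoop a b n) ∈ degLE N := by
  rw [star_planeLoop]
  exact sub_mem (hn a) (Submodule.smul_mem _ _ (hn b))

theorem star_mono (m : ℤ) : star (mono m) = mono (-m) := by
  ext z
  rw [ContinuousMap.star_apply, mono_apply, mono_apply, zpow_neg, Circle.coe_inv_eq_conj]
  rfl

/-- Twisting by `z` raises the degree by at most one. -/
theorem coord_twistLoop_mono_one_mem_degLE (a b : EuclideanSpace ℝ ι)
    (hn : ∀ y, coord n y ∈ degLE N) (y : EuclideanSpace ℝ ι) :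
    coord (twistLoop a b (mono 1) n) y ∈ degLE (N + 1) := by
  have h1 := planeLoop_mem_degLE a b hn
  have h2 := star_planeLoop_mem_degLE a b hn
  rw [coord_twistLoop, star_mono]
  refine add_mem (add_mem (degLE_mono (by omega) (hn y)) (Submodule.smul_mem _ _ (sub_mem ?_
    (degLE_mono (by omega) h1)))) (Submodule.smul_mem _ _ (sub_mem ?_ (degLE_mono (by omega) h2)))
  · exact degLE_mono (by omega) (mono_mul_mem_degLE 1 h1)
  · exact degLE_mono (by omega) (mono_mul_mem_degLE (-1) h2)

theorem coef_coord_twistLoop_mono_one (a b : EuclideanSpace ℝ ι)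
    (hn : ∀ y, coord n y ∈ degLE N) (y : EuclideanSpace ℝ ι) :
    coef (N + 1) (coord (twistLoop a b (mono 1) n) y) =
      star (planeCoord a b y) / (2 * (inner ℝ a a : ℝ)) * coef N (planeLoop a b n) := by
  have h1 := planeLoop_mem_degLE a b hn
  have h2 := star_planeLoop_mem_degLE a b hn
  rw [coord_twistLoop, star_mono, map_add, map_add, map_smul, map_smul, map_sub, map_sub,
    coef_mono_mul, coef_mono_mul, coef_eq_zero_of_mem_degLE (hn y) (by omega),
    coef_eq_zero_of_mem_degLE h1 (by omega : N < N + 1), coef_eq_zero_of_mem_degLE h2 (by omega),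
    coef_eq_zero_of_mem_degLE h2 (by omega), add_sub_cancel_right]
  simp

variable [DecidableEq ι]

theorem coef_planeLoop (s : ℤ) (a b : EuclideanSpace ℝ ι) (n : C(Circle, EuclideanSpace ℝ ι)) :
    coef s (planeLoop a b n) =
      ((inner ℝ (cosCoef s n) a + inner ℝ (sinCoef s n) b : ℝ) +
        (inner ℝ (cosCoef s n) b - inner ℝ (sinCoef s n) a : ℝ) * Complex.I) / 2 := by
  rw [planeLoop, map_add, map_smul, coef_coord, coef_coord]
  push_cast
  rw [smul_eq_mul]
  linear_combination (-(inner ℝ (sinCoef s n) b : ℝ) / 2 : ℂ) * Complex.I_sq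

theorem coef_star_planeLoop (s : ℤ) (a b : EuclideanSpace ℝ ι)
    (n : C(Circle, EuclideanSpace ℝ ι)) :
    coef s (star (planeLoop a b n)) =
      ((inner ℝ (cosCoef s n) a - inner ℝ (sinCoef s n) b : ℝ) -
        (inner ℝ (cosCoef s n) b + inner ℝ (sinCoef s n) a : ℝ) * Complex.I) / 2 := by
  rw [star_planeLoop, map_sub, map_smul, coef_coord, coef_coord]
  push_cast
  rw [smul_eq_mul]
  linear_combination ((inner ℝ (sinCoef s n) b : ℝ) / 2 : ℂ) * Complex.I_sq

/-! ### The leading coefficient of a loop on the sphere -/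

variable {R : ℝ}

theorem sum_coord_mul_coord (n : C(Circle, EuclideanSpace ℝ ι)) (z : Circle) :
    (∑ i, coord n (EuclideanSpace.single i 1) * coord n (EuclideanSpace.single i 1)) z =
      ((inner ℝ (n z) (n z) : ℝ) : ℂ) := by
  rw [real_inner_self_eq_norm_sq, EuclideanSpace.real_norm_sq_eq, Complex.ofReal_sum]
  simp [ContinuousMap.sum_apply, coord_apply, EuclideanSpace.inner_single_right, sq]

theorem sum_coord_mul_coord_eq (hs : ∀ z, inner ℝ (n z) (n z) = R ^ 2) :
    ∑ i, coord n (EuclideanSpace.single i 1) * coord n (EuclideanSpace.single i 1) =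
      ((R : ℂ) ^ 2) • mono 0 := by
  ext z
  rw [sum_coord_mul_coord, hs]
  simp [mono_zero]

/-- The leading coefficient of a loop on the sphere is isotropic: this is the coefficient of
`z ^ (2 * N)` in `n ⬝ n = R ^ 2`. -/
theorem inner_cosCoef_sinCoef (hN : 0 < N) (hn : ∀ y, coord n y ∈ degLE N)
    (hs : ∀ z, inner ℝ (n z) (n z) = R ^ 2) :
    inner ℝ (cosCoef N n) (cosCoef N n) = (inner ℝ (sinCoef N n) (sinCoef N n) : ℝ) ∧
      inner ℝ (cosCoef N n) (sinCoef N n) = (0 : ℝ) := by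
  have h := congrArg (coef (N + N)) (sum_coord_mul_coord_eq hs)
  rw [map_sum, map_smul, coef_mono, if_neg (by omega), smul_zero] at h
  simp only [coef_add_mul (hn _) (hn _)] at h
  simp only [PiLp.inner_apply, cosCoef, sinCoef]
  have hre := congrArg Complex.re h
  have him := congrArg Complex.im h
  simp only [Complex.re_sum, Complex.im_sum, Complex.mul_re, Complex.mul_im, Complex.zero_re,
    Complex.zero_im, Finset.sum_sub_distrib, Finset.sum_add_distrib] at hre him
  simp only [RCLike.inner_apply, conj_trivial]
  constructor
  · rw [← sub_eq_zero, ← Finset.sum_sub_distrib]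
    rw [← Finset.sum_sub_distrib] at hre
    rw [← mul_zero (4 : ℝ), ← hre, Finset.mul_sum]
    exact Finset.sum_congr rfl fun i _ => by ring
  · rw [← Finset.sum_add_distrib] at him
    rw [← mul_zero (-2 : ℝ), ← him, Finset.mul_sum]
    exact Finset.sum_congr rfl fun i _ => by ring

/-- For the pair formed by the leading coefficients, the conjugate of `planeLoop` has degree two
less than the loop: the component of the second highest coefficient along the conjugate
of the leading one vanishes, as the coefficient of `z ^ (2 * N + 1)` in `n ⬝ n = R ^ 2` shows. -/
theorem star_planeLoop_mem_degLE_sub_one (hN : 0 ≤ N) (hn : ∀ y, coord n y ∈ degLE (N + 1))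
    (hs : ∀ z, inner ℝ (n z) (n z) = R ^ 2) {a b : EuclideanSpace ℝ ι}
    (ha : cosCoef (N + 1) n = a) (hb : sinCoef (N + 1) n = b) (h : IsConformalPair a b) :
    star (planeLoop a b n) ∈ degLE (N - 1) ∧
      coef (N + 1) (planeLoop a b n) = (inner ℝ a a : ℝ) ∧
      ∀ y, coord (twistLoop a b 0 n) y ∈ degLE N := by
  have hq : ((inner ℝ a a : ℝ) : ℂ) ≠ 0 := Complex.ofReal_ne_zero.2 h.inner_self_pos.ne'
  have hba : inner ℝ b a = (0 : ℝ) := by rw [real_inner_comm, h.inner_eq_zero]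
  have hU : coef (N + 1) (planeLoop a b n) = (inner ℝ a a : ℝ) := by
    rw [coef_planeLoop, ha, hb, h.inner_eq_zero, hba, ← h.inner_self_eq]
    push_cast
    ring
  have hV : star (planeLoop a b n) ∈ degLE N := by
    have h0 : coef (N + 1) (star (planeLoop a b n)) = 0 := by
      rw [coef_star_planeLoop, ha, hb, h.inner_eq_zero, hba, ← h.inner_self_eq]
      simp
    simpa using mem_degLE_sub_one (star_planeLoop_mem_degLE a b hn) h0
  -- the part orthogonal to the plane contains nothing of the leading coefficient
  have hW (y) : coord (twistLoop a b 0 n) y ∈ degLE N := by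
    have e := coord_twistLoop a b 0 n y
    rw [star_zero, zero_mul, zero_mul, zero_sub, zero_sub] at e
    have hmem : coord (twistLoop a b 0 n) y ∈ degLE (N + 1) := by
      rw [e]
      exact add_mem (add_mem (hn y) (Submodule.smul_mem _ _ (neg_mem (planeLoop_mem_degLE a b hn))))
        (Submodule.smul_mem _ _ (neg_mem (star_planeLoop_mem_degLE a b hn)))
    have h0 : coef (N + 1) (coord (twistLoop a b 0 n) y) = 0 := by
      rw [e, map_add, map_add, map_smul, map_smul, map_neg, map_neg, hU,
        coef_eq_zero_of_mem_degLE hV (by omega), coef_coord, ha, hb]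
      have : star (planeCoord a b y) =
          (inner ℝ a y : ℝ) - (inner ℝ b y : ℝ) * Complex.I := by
        apply Complex.ext <;> simp [planeCoord]
      rw [this, smul_eq_mul]
      field_simp
      simp
    simpa using mem_degLE_sub_one hmem h0
  refine ⟨?_, hU, hW⟩
  -- Pythagoras: `n ⬝ n` is the sum of the squared lengths of the parts in and orthogonal to the plane
  have hUV : planeLoop a b n * star (planeLoop a b n) = ((inner ℝ a a : ℝ) : ℂ) •
      (((R : ℂ) ^ 2) • mono 0 - ∑ i, coord (twistLoop a b 0 n) (EuclideanSpace.single i 1) *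
        coord (twistLoop a b 0 n) (EuclideanSpace.single i 1)) := by
    ext z
    rw [ContinuousMap.smul_apply, ContinuousMap.sub_apply, sum_coord_mul_coord, twistLoop_apply,
      ContinuousMap.zero_apply, inner_twist_self h, hs, ContinuousMap.mul_apply,
      ContinuousMap.star_apply, planeLoop_apply]
    rw [show star (planeCoord a b (n z)) = (starRingEnd ℂ) (planeCoord a b (n z)) from rfl,
      Complex.mul_conj]
    rw [ContinuousMap.smul_apply, mono_zero, ContinuousMap.one_apply, map_zero]
    push_cast
    generalize ((inner ℝ a a : ℝ) : ℂ) = q at hq ⊢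
    simp only [smul_eq_mul]
    field_simp
    ring
  have hdeg : planeLoop a b n * star (planeLoop a b n) ∈ degLE (N + N) := by
    rw [hUV]
    exact Submodule.smul_mem _ _ (sub_mem (Submodule.smul_mem _ _ (mono_mem_degLE (by omega)))
      (sum_mem fun i _ => mul_mem_degLE (hW _) (hW _)))
  have h0 := coef_add_mul (planeLoop_mem_degLE a b hn) hV
  rw [coef_eq_zero_of_mem_degLE hdeg (by omega), hU] at h0
  exact mem_degLE_sub_one hV ((mul_eq_zero.1 h0.symm).resolve_left hq)

/-- Twisting by `z⁻¹` along the leading coefficient lowers the degree of a loop on the sphere. -/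
theorem coord_twistLoop_mono_neg_one_mem_degLE (hN : 0 ≤ N) (hn : ∀ y, coord n y ∈ degLE (N + 1))
    (hs : ∀ z, inner ℝ (n z) (n z) = R ^ 2) {a b : EuclideanSpace ℝ ι}
    (ha : cosCoef (N + 1) n = a) (hb : sinCoef (N + 1) n = b) (h : IsConformalPair a b)
    (y : EuclideanSpace ℝ ι) :
    coord (twistLoop a b (mono (-1)) n) y ∈ degLE N := by
  obtain ⟨hV, -, hW⟩ := star_planeLoop_mem_degLE_sub_one hN hn hs ha hb h
  have e : coord (twistLoop a b (mono (-1)) n) y = coord (twistLoop a b 0 n) y +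
      (star (planeCoord a b y) / (2 * (inner ℝ a a : ℝ))) • (mono (-1) * planeLoop a b n) +
      (planeCoord a b y / (2 * (inner ℝ a a : ℝ))) • (mono 1 * star (planeLoop a b n)) := by
    rw [coord_twistLoop, coord_twistLoop, star_mono, neg_neg, star_zero, zero_mul, zero_mul]
    module
  rw [e]
  refine add_mem (add_mem (hW y) (Submodule.smul_mem _ _ ?_)) (Submodule.smul_mem _ _ ?_)
  · exact degLE_mono (by omega) (mono_mul_mem_degLE (-1) (planeLoop_mem_degLE a b hn))
  · exact degLE_mono (by omega) (mono_mul_mem_degLE 1 hV)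

end TwistLoop

/-! ### Loops of exact degree -/

section ExactDegree

variable {ι : Type*} [Fintype ι]

theorem continuous_twistLoop {X : Type*} [TopologicalSpace X] {a b : X → EuclideanSpace ℝ ι}
    {n : X → C(Circle, EuclideanSpace ℝ ι)} (g : C(Circle, ℂ)) (ha : Continuous a)
    (hb : Continuous b) (hn : Continuous n) (h0 : ∀ p, a p ≠ 0) :
    Continuous fun p => twistLoop (a p) (b p) g (n p) := by
  refine ContinuousMap.continuous_of_continuous_uncurry _ ?_
  have hq : Continuous fun p => (inner ℝ (a p) (a p) : ℝ)⁻¹ :=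
    (ha.inner ha).inv₀ fun p => (real_inner_self_pos.2 (h0 p)).ne'
  exact continuous_twist (ha.comp continuous_fst) (hb.comp continuous_fst)
    (g.continuous.comp continuous_snd)
    (continuous_eval.comp ((hn.comp continuous_fst).prodMk continuous_snd))
    (hq.comp continuous_fst)

/-- The trigonometric loops of degree exactly `N` on the sphere of radius `R`. -/
def exactLoops (ι : Type*) [Fintype ι] (R : ℝ) (N : ℤ) : Set C(Circle, EuclideanSpace ℝ ι) :=
  {n | (∀ y, coord n y ∈ degLE N) ∧ (∀ z, inner ℝ (n z) (n z) = R ^ 2) ∧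
    ¬ ∀ y, coord n y ∈ degLE (N - 1)}

theorem inner_twistLoop_mono {a b : EuclideanSpace ℝ ι} (h : IsConformalPair a b) (m : ℤ)
    (n : C(Circle, EuclideanSpace ℝ ι)) (z : Circle) :
    inner ℝ (twistLoop a b (mono m) n z) (twistLoop a b (mono m) n z) =
      (inner ℝ (n z) (n z) : ℝ) := by
  rw [twistLoop_apply, inner_twist_self h, mono_apply, Circle.normSq_coe]
  ring

variable {R : ℝ} {N : ℤ} {n : C(Circle, EuclideanSpace ℝ ι)}

theorem twistLoop_mem_exactLoops_add_one (hn : n ∈ exactLoops ι R N) {a b : EuclideanSpace ℝ ι}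
    (h : IsConformalPair a b) (h0 : coef N (planeLoop a b n) ≠ 0) :
    twistLoop a b (mono 1) n ∈ exactLoops ι R (N + 1) := by
  refine ⟨coord_twistLoop_mono_one_mem_degLE a b hn.1, fun z => ?_, fun hN => h0 ?_⟩
  · rw [inner_twistLoop_mono h, hn.2.1]
  · have := coef_eq_zero_of_mem_degLE (s := N + 1) (planeLoop_mem_degLE a b hN) (by omega)
    rwa [planeLoop_twistLoop h, coef_mono_mul, add_sub_cancel_right] at this

variable [DecidableEq ι]

theorem isConformalPair_of_mem_exactLoops (hN : 1 ≤ N) (hn : n ∈ exactLoops ι R N) :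
    IsConformalPair (cosCoef N n) (sinCoef N n) := by
  obtain ⟨h1, h2, h3⟩ := hn
  obtain ⟨e1, e2⟩ := inner_cosCoef_sinCoef (by omega) h1 h2
  refine ⟨e1, e2, fun h0 => h3 fun y => mem_degLE_sub_one (h1 y) ?_⟩
  have h0' : sinCoef N n = 0 := by
    rw [h0, inner_zero_left] at e1
    exact inner_self_eq_zero.1 e1.symm
  rw [coef_coord, h0, h0']
  simp

/-- The loop of one degree less obtained by untwisting along the leading coefficient. -/
noncomputable def lower (N : ℤ) (n : C(Circle, EuclideanSpace ℝ ι)) :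
    C(Circle, EuclideanSpace ℝ ι) :=
  twistLoop (cosCoef N n) (sinCoef N n) (mono (-1)) n

/-- The loop of one degree more obtained by twisting along the leading coefficient. -/
noncomputable def raise (N : ℤ) (n : C(Circle, EuclideanSpace ℝ ι)) :
    C(Circle, EuclideanSpace ℝ ι) :=
  twistLoop (cosCoef N n) (sinCoef N n) (mono 1) n

theorem coef_planeLoop_lower (hN : 0 ≤ N) (hn : n ∈ exactLoops ι R (N + 1)) :
    coef N (planeLoop (cosCoef (N + 1) n) (sinCoef (N + 1) n) (lower (N + 1) n)) =
      (inner ℝ (cosCoef (N + 1) n) (cosCoef (N + 1) n) : ℝ) := by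
  have h := isConformalPair_of_mem_exactLoops (by omega) hn
  rw [lower, planeLoop_twistLoop h, coef_mono_mul, sub_neg_eq_add]
  exact (star_planeLoop_mem_degLE_sub_one hN hn.1 hn.2.1 rfl rfl h).2.1

theorem lower_mem_exactLoops (hN : 0 ≤ N) (hn : n ∈ exactLoops ι R (N + 1)) :
    lower (N + 1) n ∈ exactLoops ι R N := by
  have h := isConformalPair_of_mem_exactLoops (by omega) hn
  refine ⟨coord_twistLoop_mono_neg_one_mem_degLE hN hn.1 hn.2.1 rfl rfl h, fun z => ?_,
    fun hlt => ?_⟩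
  · rw [lower, inner_twistLoop_mono h, hn.2.1]
  · have h0 := coef_planeLoop_lower hN hn
    rw [coef_eq_zero_of_mem_degLE (planeLoop_mem_degLE _ _ hlt) (by omega)] at h0
    exact h.inner_self_pos.ne (Complex.ofReal_injective h0)

theorem coef_planeLoop_self (h : IsConformalPair (cosCoef N n) (sinCoef N n)) :
    coef N (planeLoop (cosCoef N n) (sinCoef N n) n) =
      (inner ℝ (cosCoef N n) (cosCoef N n) : ℝ) := by
  rw [coef_planeLoop, h.inner_eq_zero, real_inner_comm (cosCoef N n) (sinCoef N n),
    h.inner_eq_zero, ← h.inner_self_eq]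
  push_cast
  ring

theorem raise_mem_exactLoops (hN : 1 ≤ N) (hn : n ∈ exactLoops ι R N) :
    raise N n ∈ exactLoops ι R (N + 1) := by
  have h := isConformalPair_of_mem_exactLoops hN hn
  refine twistLoop_mem_exactLoops_add_one hn h ?_
  rw [coef_planeLoop_self h]
  exact Complex.ofReal_ne_zero.2 h.inner_self_pos.ne'

/-- Raising the degree does not change the leading coefficient. -/
theorem cosCoef_sinCoef_raise (hN : 1 ≤ N) (hn : n ∈ exactLoops ι R N) :
    cosCoef (N + 1) (raise N n) = cosCoef N n ∧ sinCoef (N + 1) (raise N n) = sinCoef N n := by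
  have h := isConformalPair_of_mem_exactLoops hN hn
  have hq : ((inner ℝ (cosCoef N n) (cosCoef N n) : ℝ) : ℂ) ≠ 0 :=
    Complex.ofReal_ne_zero.2 h.inner_self_pos.ne'
  refine cosCoef_sinCoef_eq_of_coef_coord fun y => ?_
  rw [raise, coef_coord_twistLoop_mono_one _ _ hn.1, coef_planeLoop_self h]
  have : star (planeCoord (cosCoef N n) (sinCoef N n) y) =
      (inner ℝ (cosCoef N n) y : ℝ) - (inner ℝ (sinCoef N n) y : ℝ) * Complex.I := by
    apply Complex.ext <;> simp [planeCoord]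
  rw [this]
  generalize ((inner ℝ (cosCoef N n) (cosCoef N n) : ℝ) : ℂ) = q at hq
  field_simp

theorem lower_raise (hN : 1 ≤ N) (hn : n ∈ exactLoops ι R N) : lower (N + 1) (raise N n) = n := by
  have h := isConformalPair_of_mem_exactLoops hN hn
  obtain ⟨e1, e2⟩ := cosCoef_sinCoef_raise hN hn
  rw [lower, e1, e2, raise, twistLoop_twistLoop h, mono_mul_mono, neg_add_cancel, mono_zero,
    twistLoop_one]

/-- The homotopy from the identity to `raise N ∘ lower (N + 1)`: untwist along the leading
coefficient of `n`, then twist along a pair on the path from that coefficient to the leading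
coefficient of `lower (N + 1) n`. -/
noncomputable def raiseLower (N : ℤ) (t : ℝ) (n : C(Circle, EuclideanSpace ℝ ι)) :
    C(Circle, EuclideanSpace ℝ ι) :=
  twistLoop
    (bridge (cosCoef (N + 1) n) (sinCoef (N + 1) n) (cosCoef (N + 1) n)
      (cosCoef N (lower (N + 1) n)) t)
    (bridge (cosCoef (N + 1) n) (sinCoef (N + 1) n) (sinCoef (N + 1) n)
      (sinCoef N (lower (N + 1) n)) t)
    (mono 1) (lower (N + 1) n)

theorem raiseLower_zero (hN : 0 ≤ N) (hn : n ∈ exactLoops ι R (N + 1)) : raiseLower N 0 n = n := by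
  have h := isConformalPair_of_mem_exactLoops (by omega) hn
  rw [raiseLower, bridge_zero, bridge_zero, lower, twistLoop_twistLoop h, mono_mul_mono,
    add_neg_cancel, mono_zero, twistLoop_one]

theorem raiseLower_one (N : ℤ) (n : C(Circle, EuclideanSpace ℝ ι)) :
    raiseLower N 1 n = raise N (lower (N + 1) n) := by
  rw [raiseLower, bridge_one, bridge_one, raise]

theorem isConformalPair_raiseLower (hN : 1 ≤ N) (hn : n ∈ exactLoops ι R (N + 1)) {t : ℝ}
    (ht : 0 ≤ t) :
    IsConformalPair
      (bridge (cosCoef (N + 1) n) (sinCoef (N + 1) n) (cosCoef (N + 1) n)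
        (cosCoef N (lower (N + 1) n)) t)
      (bridge (cosCoef (N + 1) n) (sinCoef (N + 1) n) (sinCoef (N + 1) n)
        (sinCoef N (lower (N + 1) n)) t) ∧
    (0 : ℝ) < inner ℝ (cosCoef N (lower (N + 1) n))
      (bridge (cosCoef (N + 1) n) (sinCoef (N + 1) n) (cosCoef (N + 1) n)
        (cosCoef N (lower (N + 1) n)) t) +
      inner ℝ (sinCoef N (lower (N + 1) n))
      (bridge (cosCoef (N + 1) n) (sinCoef (N + 1) n) (sinCoef (N + 1) n)
        (sinCoef N (lower (N + 1) n)) t) := by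
  have h := isConformalPair_of_mem_exactLoops (by omega) hn
  have h' := isConformalPair_of_mem_exactLoops hN (lower_mem_exactLoops (by omega) hn)
  have e := coef_planeLoop_lower (by omega) hn
  obtain ⟨q, hq⟩ : ∃ q : ℝ, q = inner ℝ (cosCoef (N + 1) n) (cosCoef (N + 1) n) := ⟨_, rfl⟩
  rw [coef_planeLoop, ← hq] at e
  have hre := congrArg Complex.re e
  have him := congrArg Complex.im e
  simp at hre him
  refine isConformalPair_bridge h h'.inner_self_eq h'.inner_eq_zero ?_ ?_ ht
  · rw [← hq]
    linarith
  · linarith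

theorem raiseLower_mem_exactLoops (hN : 1 ≤ N) (hn : n ∈ exactLoops ι R (N + 1)) {t : ℝ}
    (ht : 0 ≤ t) : raiseLower N t n ∈ exactLoops ι R (N + 1) := by
  obtain ⟨h1, h2⟩ := isConformalPair_raiseLower hN hn ht
  refine twistLoop_mem_exactLoops_add_one (lower_mem_exactLoops (by omega) hn) h1 fun h0 => ?_
  rw [coef_planeLoop] at h0
  have hre := congrArg Complex.re h0
  simp at hre
  linarith

theorem continuous_lower (hN : 1 ≤ N) :
    Continuous fun n : exactLoops ι R N => lower N (n : C(Circle, EuclideanSpace ℝ ι)) :=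
  continuous_twistLoop _ ((continuous_cosCoef N).comp continuous_subtype_val)
    ((continuous_sinCoef N).comp continuous_subtype_val) continuous_subtype_val
    fun n => (isConformalPair_of_mem_exactLoops hN n.2).ne_zero

theorem continuous_raise (hN : 1 ≤ N) :
    Continuous fun n : exactLoops ι R N => raise N (n : C(Circle, EuclideanSpace ℝ ι)) :=
  continuous_twistLoop _ ((continuous_cosCoef N).comp continuous_subtype_val)
    ((continuous_sinCoef N).comp continuous_subtype_val) continuous_subtype_val
    fun n => (isConformalPair_of_mem_exactLoops hN n.2).ne_zero

theorem continuous_raiseLower (hN : 1 ≤ N) :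
    Continuous fun p : unitInterval × exactLoops ι R (N + 1) =>
      raiseLower N p.1 (p.2 : C(Circle, EuclideanSpace ℝ ι)) := by
  have ht : Continuous fun p : unitInterval × exactLoops ι R (N + 1) => (p.1 : ℝ) :=
    continuous_subtype_val.comp continuous_fst
  have hl : Continuous fun p : unitInterval × exactLoops ι R (N + 1) =>
      lower (N + 1) (p.2 : C(Circle, EuclideanSpace ℝ ι)) :=
    (continuous_lower (by omega)).comp continuous_snd
  have ha : Continuous fun p : unitInterval × exactLoops ι R (N + 1) =>
      cosCoef (N + 1) (p.2 : C(Circle, EuclideanSpace ℝ ι)) :=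
    (continuous_cosCoef _).comp (continuous_subtype_val.comp continuous_snd)
  have hb : Continuous fun p : unitInterval × exactLoops ι R (N + 1) =>
      sinCoef (N + 1) (p.2 : C(Circle, EuclideanSpace ℝ ι)) :=
    (continuous_sinCoef _).comp (continuous_subtype_val.comp continuous_snd)
  have hq := (ha.inner (𝕜 := ℝ) ha).inv₀ fun p => (real_inner_self_pos.2
    (isConformalPair_of_mem_exactLoops (by omega : 1 ≤ N + 1) p.2.2).ne_zero).ne'
  have hc := (continuous_cosCoef N).comp hl
  have hd := (continuous_sinCoef N).comp hl
  have hwc := continuous_twist ha hb (continuous_const (y := (0 : ℂ))) hc hq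
  have hwd := continuous_twist ha hb (continuous_const (y := (0 : ℂ))) hd hq
  refine continuous_twistLoop _ ?_ ?_ hl
    fun p => (isConformalPair_raiseLower hN p.2.2 p.1.2.1).1.ne_zero
  · exact (ha.add (ht.smul hwc)).add ((ht.pow 2).smul ((hc.sub hwc).sub ha))
  · exact (hb.add (ht.smul hwd)).add ((ht.pow 2).smul ((hd.sub hwd).sub hb))

/-- The map `lower` between spaces of loops of exact degree. -/
noncomputable def lowerMap (ι : Type*) [Fintype ι] [DecidableEq ι] (R : ℝ) (hN : 1 ≤ N) :
    C(exactLoops ι R (N + 1), exactLoops ι R N) :=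
  ⟨fun n => ⟨lower (N + 1) n.1, lower_mem_exactLoops (by omega) n.2⟩,
    (continuous_lower (by omega)).subtype_mk _⟩

/-- The map `raise` between spaces of loops of exact degree. -/
noncomputable def raiseMap (ι : Type*) [Fintype ι] [DecidableEq ι] (R : ℝ) (hN : 1 ≤ N) :
    C(exactLoops ι R N, exactLoops ι R (N + 1)) :=
  ⟨fun n => ⟨raise N n.1, raise_mem_exactLoops hN n.2⟩, (continuous_raise hN).subtype_mk _⟩

theorem lowerMap_comp_raiseMap (hN : 1 ≤ N) :
    (lowerMap ι R hN).comp (raiseMap ι R hN) = ContinuousMap.id _ :=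
  ContinuousMap.ext fun n => Subtype.ext (lower_raise hN n.2)

theorem homotopic_raiseMap_comp_lowerMap (hN : 1 ≤ N) :
    (ContinuousMap.id _).Homotopic ((raiseMap ι R hN).comp (lowerMap ι R hN)) := by
  refine ⟨⟨⟨fun p => ⟨raiseLower N p.1 p.2.1, raiseLower_mem_exactLoops hN p.2.2 p.1.2.1⟩,
    (continuous_raiseLower hN).subtype_mk _⟩, fun n => ?_, fun n => ?_⟩⟩
  · exact Subtype.ext (raiseLower_zero (by omega) n.2)
  · exact Subtype.ext (raiseLower_one N n.1)

/-- Lowering the degree is a homotopy equivalence, with homotopy inverse the raising of the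
degree. -/
noncomputable def exactLoopsEquiv (ι : Type*) [Fintype ι] [DecidableEq ι] (R : ℝ) (hN : 1 ≤ N) :
    exactLoops ι R (N + 1) ≃ₕ exactLoops ι R N where
  toFun := lowerMap ι R hN
  invFun := raiseMap ι R hN
  left_inv := (homotopic_raiseMap_comp_lowerMap hN).symm
  right_inv := by rw [lowerMap_comp_raiseMap]

theorem sphereLoops_diff_eq (k N : ℕ) (R : ℝ) :
    sphereLoops k R (N + 1) \ sphereLoops k R N = exactLoops (Fin (k + 1)) R (N + 1) := by
  ext n
  simp only [sphereLoops, exactLoops, Set.mem_sdiff, Set.mem_ofPred_eq, mem_trigLoops_iff,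
    Nat.cast_add, Nat.cast_one, add_sub_cancel_right]
  tauto

end ExactDegree

/-! ### Circles on the sphere and the Stiefel manifold -/

section Stiefel

variable {ι : Type*} [Fintype ι]

/-- The loop `θ ↦ v + cos θ • a + sin θ • b`. -/
noncomputable def ellipse (v a b : EuclideanSpace ℝ ι) : C(Circle, EuclideanSpace ℝ ι) :=
  ⟨fun z => v + (z : ℂ).re • a + (z : ℂ).im • b, by fun_prop⟩

theorem ellipse_apply (v a b : EuclideanSpace ℝ ι) (z : Circle) :
    ellipse v a b z = v + (z : ℂ).re • a + (z : ℂ).im • b := rfl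

theorem ellipse_exp (v a b : EuclideanSpace ℝ ι) (θ : ℝ) :
    ellipse v a b (Circle.exp θ) = v + Real.cos θ • a + Real.sin θ • b := by
  rw [ellipse_apply, Circle.coe_exp, Complex.exp_ofReal_mul_I_re, Complex.exp_ofReal_mul_I_im]

theorem continuous_ellipse {X : Type*} [TopologicalSpace X] {v a b : X → EuclideanSpace ℝ ι}
    (hv : Continuous v) (ha : Continuous a) (hb : Continuous b) :
    Continuous fun p => ellipse (v p) (a p) (b p) := by
  refine ContinuousMap.continuous_of_continuous_uncurry _ ?_
  change Continuous fun p : X × Circle =>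
    v p.1 + (p.2 : ℂ).re • a p.1 + (p.2 : ℂ).im • b p.1
  fun_prop

/-- The centre `v` of a loop `θ ↦ v + cos θ • a + sin θ • b`. -/
noncomputable def center (n : C(Circle, EuclideanSpace ℝ ι)) : EuclideanSpace ℝ ι :=
  (1 / 2 : ℝ) • (n (Circle.exp 0) + n (Circle.exp Real.pi))

/-- The vector `a` of a loop `θ ↦ v + cos θ • a + sin θ • b`. -/
noncomputable def axis₁ (n : C(Circle, EuclideanSpace ℝ ι)) : EuclideanSpace ℝ ι :=
  (1 / 2 : ℝ) • (n (Circle.exp 0) - n (Circle.exp Real.pi))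

/-- The vector `b` of a loop `θ ↦ v + cos θ • a + sin θ • b`. -/
noncomputable def axis₂ (n : C(Circle, EuclideanSpace ℝ ι)) : EuclideanSpace ℝ ι :=
  (1 / 2 : ℝ) • (n (Circle.exp (Real.pi / 2)) - n (Circle.exp (-(Real.pi / 2))))

theorem center_ellipse (v a b : EuclideanSpace ℝ ι) : center (ellipse v a b) = v := by
  simp only [center, ellipse_exp, Real.cos_zero, Real.sin_zero, Real.cos_pi, Real.sin_pi]
  module

theorem axis₁_ellipse (v a b : EuclideanSpace ℝ ι) : axis₁ (ellipse v a b) = a := by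
  simp only [axis₁, ellipse_exp, Real.cos_zero, Real.sin_zero, Real.cos_pi, Real.sin_pi]
  module

theorem axis₂_ellipse (v a b : EuclideanSpace ℝ ι) : axis₂ (ellipse v a b) = b := by
  simp only [axis₂, ellipse_exp, Real.cos_neg, Real.sin_neg, Real.cos_pi_div_two,
    Real.sin_pi_div_two]
  module

theorem continuous_center :
    Continuous (center : C(Circle, EuclideanSpace ℝ ι) → EuclideanSpace ℝ ι) := by
  unfold center
  fun_prop

theorem continuous_axis₁ :
    Continuous (axis₁ : C(Circle, EuclideanSpace ℝ ι) → EuclideanSpace ℝ ι) := by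
  unfold axis₁
  fun_prop

theorem continuous_axis₂ :
    Continuous (axis₂ : C(Circle, EuclideanSpace ℝ ι) → EuclideanSpace ℝ ι) := by
  unfold axis₂
  fun_prop

/-- An ellipse lies on the sphere of radius `R` about the origin precisely when it is a circle whose
plane is orthogonal to the vector from the origin to its centre, of the right radius. -/
theorem inner_ellipse_eq_iff {v a b : EuclideanSpace ℝ ι} {R : ℝ} :
    (∀ z, inner ℝ (ellipse v a b z) (ellipse v a b z) = R ^ 2) ↔
      inner ℝ v a = (0 : ℝ) ∧ inner ℝ v b = (0 : ℝ) ∧ inner ℝ a b = (0 : ℝ) ∧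
      inner ℝ a a = (inner ℝ b b : ℝ) ∧ inner ℝ v v + inner ℝ a a = R ^ 2 := by
  have key (z : Circle) : inner ℝ (ellipse v a b z) (ellipse v a b z) =
      inner ℝ v v + (z : ℂ).re ^ 2 * inner ℝ a a + (z : ℂ).im ^ 2 * inner ℝ b b +
      2 * (z : ℂ).re * inner ℝ v a + 2 * (z : ℂ).im * inner ℝ v b +
      2 * ((z : ℂ).re * (z : ℂ).im) * (inner ℝ a b : ℝ) := by
    rw [ellipse_apply]
    simp only [inner_add_left, inner_add_right, real_inner_smul_left, real_inner_smul_right,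
      real_inner_comm v a, real_inner_comm v b, real_inner_comm a b]
    ring
  have hz (θ : ℝ) : ((Circle.exp θ : ℂ)).re = Real.cos θ ∧ ((Circle.exp θ : ℂ)).im = Real.sin θ := by
    rw [Circle.coe_exp]
    exact ⟨Complex.exp_ofReal_mul_I_re θ, Complex.exp_ofReal_mul_I_im θ⟩
  constructor
  · intro h
    have h0 := (key (Circle.exp 0)).symm.trans (h _)
    have h1 := (key (Circle.exp Real.pi)).symm.trans (h _)
    have h2 := (key (Circle.exp (Real.pi / 2))).symm.trans (h _)
    have h3 := (key (Circle.exp (-(Real.pi / 2)))).symm.trans (h _)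
    -- the four points on the axes leave only the mixed term at `π / 4`
    have h4 := (key (Circle.exp (Real.pi / 4))).symm.trans (h _)
    rw [(hz _).1, (hz _).2] at h0 h1 h2 h3 h4
    simp only [Real.cos_zero, Real.sin_zero] at h0
    simp only [Real.cos_pi, Real.sin_pi] at h1
    simp only [Real.cos_pi_div_two, Real.sin_pi_div_two, Real.cos_neg, Real.sin_neg] at h2 h3
    simp only [Real.cos_pi_div_four, Real.sin_pi_div_four, div_pow, div_mul_div_comm,
      Real.mul_self_sqrt zero_le_two, Real.sq_sqrt zero_le_two] at h4
    have e1 : inner ℝ v a = (0 : ℝ) := by linarith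
    have e2 : inner ℝ v b = (0 : ℝ) := by linarith
    rw [e1, e2] at h0 h1 h2 h3 h4 ⊢
    refine ⟨rfl, rfl, ?_, ?_, ?_⟩ <;> linarith
  · rintro ⟨h1, h2, h3, h4, h5⟩ z
    have hz' : (z : ℂ).re ^ 2 + (z : ℂ).im ^ 2 = 1 := by
      have := Circle.normSq_coe z
      rw [Complex.normSq_apply] at this
      linarith
    rw [key, h1, h2, h3]
    linear_combination h5 + (inner ℝ a a : ℝ) * hz' - (z : ℂ).im ^ 2 * h4

theorem mem_trigLoops_one_iff {k : ℕ} {n : C(Circle, EuclideanSpace ℝ (Fin (k + 1)))} :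
    n ∈ trigLoops k 1 ↔ ∃ v a b, n = ellipse v a b := by
  constructor
  · rintro ⟨v, a, b, h⟩
    refine ⟨v, a 1, b 1, ContinuousMap.ext fun z => ?_⟩
    obtain ⟨θ, rfl⟩ := Circle.exp_surjective z
    rw [h, ellipse_exp]
    simp [add_assoc]
  · rintro ⟨v, a, b, rfl⟩
    refine ⟨v, fun _ => a, fun _ => b, fun θ => ?_⟩
    rw [ellipse_exp]
    simp [add_assoc]

theorem ellipse_mem_trigLoops_zero_iff {k : ℕ} {v a b : EuclideanSpace ℝ (Fin (k + 1))} :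
    ellipse v a b ∈ trigLoops k 0 ↔ a = 0 ∧ b = 0 := by
  constructor
  · rintro ⟨w, a', b', h⟩
    simp only [zero_lt_one, Finset.Icc_eq_empty_of_lt, Finset.sum_empty, add_zero] at h
    refine ⟨(axis₁_ellipse v a b).symm.trans ?_, (axis₂_ellipse v a b).symm.trans ?_⟩
    · rw [axis₁, h, h, sub_self, smul_zero]
    · rw [axis₂, h, h, sub_self, smul_zero]
  · rintro ⟨rfl, rfl⟩
    exact ⟨v, 0, 0, fun θ => by simp [ellipse_exp]⟩

/-- The loops of degree exactly one on the sphere are the circles of positive radius. -/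
theorem ellipse_mem_sphereLoops_diff_iff {k : ℕ} {R : ℝ}
    {v a b : EuclideanSpace ℝ (Fin (k + 1))} :
    ellipse v a b ∈ sphereLoops k R 1 \ sphereLoops k R 0 ↔
      (inner ℝ v a = (0 : ℝ) ∧ inner ℝ v b = (0 : ℝ) ∧ inner ℝ a b = (0 : ℝ) ∧
      inner ℝ a a = (inner ℝ b b : ℝ) ∧ inner ℝ v v + inner ℝ a a = R ^ 2) ∧ a ≠ 0 := by
  have h1 : ellipse v a b ∈ trigLoops k 1 := mem_trigLoops_one_iff.2 ⟨v, a, b, rfl⟩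
  simp only [sphereLoops, Set.mem_sdiff, Set.mem_ofPred_eq, h1, true_and, inner_ellipse_eq_iff,
    ellipse_mem_trigLoops_zero_iff]
  refine and_congr_right fun h => ?_
  have : a = 0 → b = 0 := fun ha => by
    have := h.2.2.2.1
    rw [ha, inner_zero_left] at this
    exact inner_self_eq_zero.1 this.symm
  tauto

theorem eq_ellipse_of_mem {k : ℕ} {R : ℝ} {n : C(Circle, EuclideanSpace ℝ (Fin (k + 1)))}
    (hn : n ∈ sphereLoops k R 1 \ sphereLoops k R 0) :
    n = ellipse (center n) (axis₁ n) (axis₂ n) := by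
  obtain ⟨v, a, b, rfl⟩ := mem_trigLoops_one_iff.1 hn.1.1
  rw [center_ellipse, axis₁_ellipse, axis₂_ellipse]

/-- A column of a matrix, as a vector of Euclidean space. -/
def column {m d : ℕ} (V : Matrix (Fin d) (Fin m) ℝ) (j : Fin m) : EuclideanSpace ℝ (Fin d) :=
  WithLp.toLp 2 fun i => V i j

theorem mem_stiefelManifold_two_iff {d : ℕ} {V : Matrix (Fin d) (Fin 2) ℝ} :
    V ∈ stiefelManifold 2 d ↔ inner ℝ (column V 0) (column V 0) = (1 : ℝ) ∧
      inner ℝ (column V 0) (column V 1) = (0 : ℝ) ∧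
      inner ℝ (column V 1) (column V 1) = (1 : ℝ) := by
  have key (i j : Fin 2) : (V.transpose * V) i j = inner ℝ (column V j) (column V i) := by
    simp [Matrix.mul_apply, PiLp.inner_apply, column]
  change V.transpose * V = 1 ↔ _
  rw [← Matrix.ext_iff]
  simp only [Fin.forall_fin_two, key, Matrix.one_apply_eq, ne_eq, Matrix.one_apply_ne, zero_ne_one,
    one_ne_zero, not_false_eq_true, real_inner_comm (column V 0) (column V 1)]
  tauto

/-- The matrix with columns `a` and `b`. -/
def ofColumns {d : ℕ} (a b : EuclideanSpace ℝ (Fin d)) : Matrix (Fin d) (Fin 2) ℝ :=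
  Matrix.of fun i j => (![a, b] j) i

theorem column_ofColumns_zero {d : ℕ} (a b : EuclideanSpace ℝ (Fin d)) :
    column (ofColumns a b) 0 = a := rfl

theorem column_ofColumns_one {d : ℕ} (a b : EuclideanSpace ℝ (Fin d)) :
    column (ofColumns a b) 1 = b := rfl

theorem ofColumns_column {d : ℕ} (V : Matrix (Fin d) (Fin 2) ℝ) :
    ofColumns (column V 0) (column V 1) = V := by
  ext i j
  fin_cases j <;> rfl

theorem continuous_column {m d : ℕ} (j : Fin m) :
    Continuous fun V : Matrix (Fin d) (Fin m) ℝ => column V j :=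
  (PiLp.continuous_toLp 2 _).comp
    (continuous_pi fun i => (continuous_apply j).comp (continuous_apply i))

theorem continuous_ofColumns {X : Type*} [TopologicalSpace X] {d : ℕ}
    {a b : X → EuclideanSpace ℝ (Fin d)} (ha : Continuous a) (hb : Continuous b) :
    Continuous fun p => ofColumns (a p) (b p) := by
  refine continuous_pi fun i => continuous_pi fun j => ?_
  fin_cases j
  · exact (PiLp.continuous_apply 2 _ i).comp ha
  · exact (PiLp.continuous_apply 2 _ i).comp hb

end Stiefel

section GreatCircle

variable {k : ℕ} {R : ℝ}

/-- The great circle of the sphere of radius `R` spanned by an orthonormal pair. -/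
noncomputable def greatCircle (R : ℝ) (V : Matrix (Fin (k + 1)) (Fin 2) ℝ) :
    C(Circle, EuclideanSpace ℝ (Fin (k + 1))) :=
  ellipse 0 (R • column V 0) (R • column V 1)

theorem greatCircle_mem (hR : 0 < R) {V : Matrix (Fin (k + 1)) (Fin 2) ℝ}
    (hV : V ∈ stiefelManifold 2 (k + 1)) :
    greatCircle R V ∈ sphereLoops k R 1 \ sphereLoops k R 0 := by
  obtain ⟨h0, h01, h1⟩ := mem_stiefelManifold_two_iff.1 hV
  rw [greatCircle, ellipse_mem_sphereLoops_diff_iff]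
  simp only [inner_zero_left, real_inner_smul_left, real_inner_smul_right, h0, h01, h1]
  refine ⟨⟨trivial, trivial, by ring, trivial, by ring⟩, smul_ne_zero hR.ne' fun h => ?_⟩
  rw [h, inner_zero_left] at h0
  exact zero_ne_one h0

/-- The orthonormal frame given by the axes of a circle. -/
noncomputable def frame (n : C(Circle, EuclideanSpace ℝ (Fin (k + 1)))) :
    Matrix (Fin (k + 1)) (Fin 2) ℝ :=
  ofColumns (‖axis₁ n‖⁻¹ • axis₁ n) (‖axis₁ n‖⁻¹ • axis₂ n)

theorem axis_of_mem {n : C(Circle, EuclideanSpace ℝ (Fin (k + 1)))}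
    (hn : n ∈ sphereLoops k R 1 \ sphereLoops k R 0) :
    (inner ℝ (center n) (axis₁ n) = (0 : ℝ) ∧ inner ℝ (center n) (axis₂ n) = (0 : ℝ) ∧
      inner ℝ (axis₁ n) (axis₂ n) = (0 : ℝ) ∧
      inner ℝ (axis₁ n) (axis₁ n) = (inner ℝ (axis₂ n) (axis₂ n) : ℝ) ∧
      inner ℝ (center n) (center n) + inner ℝ (axis₁ n) (axis₁ n) = R ^ 2) ∧ axis₁ n ≠ 0 := by
  rw [← ellipse_mem_sphereLoops_diff_iff, ← eq_ellipse_of_mem hn]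
  exact hn

theorem frame_mem {n : C(Circle, EuclideanSpace ℝ (Fin (k + 1)))}
    (hn : n ∈ sphereLoops k R 1 \ sphereLoops k R 0) : frame n ∈ stiefelManifold 2 (k + 1) := by
  obtain ⟨⟨-, -, h1, h2, -⟩, h0⟩ := axis_of_mem hn
  have hne := norm_ne_zero_iff.2 h0
  rw [mem_stiefelManifold_two_iff, frame, column_ofColumns_zero, column_ofColumns_one]
  simp only [real_inner_smul_left, real_inner_smul_right, h1, ← h2]
  rw [real_inner_self_eq_norm_sq]
  refine ⟨?_, by ring, ?_⟩ <;> field_simp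

/-- The homotopy that moves a circle on the sphere through parallel circles to a great circle. -/
noncomputable def inflate (R t : ℝ) (n : C(Circle, EuclideanSpace ℝ (Fin (k + 1)))) :
    C(Circle, EuclideanSpace ℝ (Fin (k + 1))) :=
  ellipse ((1 - t) • center n)
    ((Real.sqrt (R ^ 2 - (1 - t) ^ 2 * ‖center n‖ ^ 2) * ‖axis₁ n‖⁻¹) • axis₁ n)
    ((Real.sqrt (R ^ 2 - (1 - t) ^ 2 * ‖center n‖ ^ 2) * ‖axis₁ n‖⁻¹) • axis₂ n)

theorem inflate_mem {n : C(Circle, EuclideanSpace ℝ (Fin (k + 1)))}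
    (hn : n ∈ sphereLoops k R 1 \ sphereLoops k R 0) {t : ℝ} (ht : t ∈ unitInterval) :
    inflate R t n ∈ sphereLoops k R 1 \ sphereLoops k R 0 := by
  obtain ⟨⟨h1, h2, h3, h4, h5⟩, h0⟩ := axis_of_mem hn
  have hpos : 0 < ‖axis₁ n‖ := norm_pos_iff.2 h0
  rw [real_inner_self_eq_norm_sq, real_inner_self_eq_norm_sq] at h5
  have hr : 0 < R ^ 2 - (1 - t) ^ 2 * ‖center n‖ ^ 2 := by
    have ht' : (1 - t) ^ 2 ≤ 1 := pow_le_one₀ (by linarith [ht.2]) (by linarith [ht.1])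
    nlinarith [mul_le_mul_of_nonneg_right ht' (sq_nonneg ‖center n‖)]
  rw [inflate, ellipse_mem_sphereLoops_diff_iff]
  simp only [real_inner_smul_left, real_inner_smul_right, h1, h2, h3, ← h4, mul_zero, true_and]
  refine ⟨?_, smul_ne_zero (mul_pos (Real.sqrt_pos.2 hr) (inv_pos.2 hpos)).ne' h0⟩
  rw [real_inner_self_eq_norm_sq, real_inner_self_eq_norm_sq]
  have e := Real.mul_self_sqrt hr.le
  generalize Real.sqrt (R ^ 2 - (1 - t) ^ 2 * ‖center n‖ ^ 2) = s at e
  field_simp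
  linarith

theorem inflate_zero {n : C(Circle, EuclideanSpace ℝ (Fin (k + 1)))}
    (hn : n ∈ sphereLoops k R 1 \ sphereLoops k R 0) : inflate R 0 n = n := by
  obtain ⟨⟨-, -, -, -, h5⟩, h0⟩ := axis_of_mem hn
  rw [real_inner_self_eq_norm_sq, real_inner_self_eq_norm_sq] at h5
  have e : R ^ 2 - (1 - 0) ^ 2 * ‖center n‖ ^ 2 = ‖axis₁ n‖ ^ 2 := by linarith
  rw [inflate, e, Real.sqrt_sq (norm_nonneg _), mul_inv_cancel₀ (norm_ne_zero_iff.2 h0), sub_zero,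
    one_smul, one_smul, one_smul, ← eq_ellipse_of_mem hn]

theorem inflate_one (hR : 0 < R) (n : C(Circle, EuclideanSpace ℝ (Fin (k + 1)))) :
    inflate R 1 n = greatCircle R (frame n) := by
  have e : R ^ 2 - (1 - 1) ^ 2 * ‖center n‖ ^ 2 = R ^ 2 := by ring
  rw [inflate, e, Real.sqrt_sq hR.le, greatCircle, frame, column_ofColumns_zero,
    column_ofColumns_one, smul_smul, smul_smul, sub_self, zero_smul]

theorem frame_greatCircle (hR : 0 < R) {V : Matrix (Fin (k + 1)) (Fin 2) ℝ}
    (hV : V ∈ stiefelManifold 2 (k + 1)) : frame (greatCircle R V) = V := by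
  have h0 := (mem_stiefelManifold_two_iff.1 hV).1
  rw [real_inner_self_eq_norm_sq, pow_eq_one_iff_of_nonneg (norm_nonneg _) two_ne_zero] at h0
  rw [frame, greatCircle, axis₁_ellipse, axis₂_ellipse, norm_smul, h0, mul_one, Real.norm_eq_abs,
    abs_of_pos hR, smul_smul, smul_smul, inv_mul_cancel₀ hR.ne', one_smul, one_smul,
    ofColumns_column]

/-- The map `frame` on the circles of positive radius. -/
noncomputable def frameMap (k : ℕ) (R : ℝ) :
    C(↥(sphereLoops k R 1 \ sphereLoops k R 0), stiefelManifold 2 (k + 1)) where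
  toFun n := ⟨frame n.1, frame_mem n.2⟩
  continuous_toFun := by
    have h1 := continuous_axis₁.comp
      (continuous_subtype_val (p := (· ∈ sphereLoops k R 1 \ sphereLoops k R 0)))
    have h2 := continuous_axis₂.comp
      (continuous_subtype_val (p := (· ∈ sphereLoops k R 1 \ sphereLoops k R 0)))
    have h := h1.norm.inv₀ fun n => norm_ne_zero_iff.2 (axis_of_mem n.2).2
    exact (continuous_ofColumns (h.smul h1) (h.smul h2)).subtype_mk _

/-- The map `greatCircle` on the Stiefel manifold. -/
noncomputable def greatCircleMap (k : ℕ) (hR : 0 < R) :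
    C(stiefelManifold 2 (k + 1), ↥(sphereLoops k R 1 \ sphereLoops k R 0)) where
  toFun V := ⟨greatCircle R V.1, greatCircle_mem hR V.2⟩
  continuous_toFun := (continuous_ellipse continuous_const
    (((continuous_column 0).comp continuous_subtype_val).const_smul R)
    (((continuous_column 1).comp continuous_subtype_val).const_smul R)).subtype_mk _

theorem frameMap_comp_greatCircleMap (hR : 0 < R) :
    (frameMap k R).comp (greatCircleMap k hR) = ContinuousMap.id _ :=
  ContinuousMap.ext fun V => Subtype.ext (frame_greatCircle hR V.2)

theorem homotopic_greatCircleMap_comp_frameMap (hR : 0 < R) :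
    (ContinuousMap.id _).Homotopic ((greatCircleMap k hR).comp (frameMap k R)) := by
  refine ⟨⟨⟨fun p => ⟨inflate R p.1 p.2.1, inflate_mem p.2.2 p.1.2⟩, ?_⟩, fun n => ?_,
    fun n => ?_⟩⟩
  · have hs : Continuous fun p : unitInterval × ↥(sphereLoops k R 1 \ sphereLoops k R 0) =>
        (p.2 : C(Circle, EuclideanSpace ℝ (Fin (k + 1)))) :=
      continuous_subtype_val.comp continuous_snd
    have h0 := continuous_center.comp hs
    have h1 := continuous_axis₁.comp hs
    have h2 := continuous_axis₂.comp hs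
    have ht : Continuous fun p : unitInterval × ↥(sphereLoops k R 1 \ sphereLoops k R 0) =>
        1 - (p.1 : ℝ) := by fun_prop
    have h := h1.norm.inv₀ fun p => norm_ne_zero_iff.2 (axis_of_mem p.2.2).2
    have hr := (continuous_const (y := R ^ 2)).sub ((ht.pow 2).mul (h0.norm.pow 2))
    exact (continuous_ellipse (ht.smul h0) ((hr.sqrt.mul h).smul h1)
      ((hr.sqrt.mul h).smul h2)).subtype_mk _
  · exact Subtype.ext (inflate_zero n.2)
  · exact Subtype.ext (inflate_one hR n.1)

/-- Circles on the sphere deform to great circles, which correspond to orthonormal frames. -/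
noncomputable def stiefelEquiv (k : ℕ) (hR : 0 < R) :
    ↥(sphereLoops k R 1 \ sphereLoops k R 0) ≃ₕ stiefelManifold 2 (k + 1) where
  toFun := frameMap k R
  invFun := greatCircleMap k hR
  left_inv := (homotopic_greatCircleMap_comp_frameMap hR).symm
  right_inv := by rw [frameMap_comp_greatCircleMap]

end GreatCircle

/-! ### Strata of loops on the sphere -/

theorem nonempty_sphereLoops_equiv (k : ℕ) (R : ℝ) (N : ℕ) (hN : 1 ≤ N) :
    Nonempty (↥(sphereLoops k R (N + 1) \ sphereLoops k R N) ≃ₕ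
      ↥(sphereLoops k R N \ sphereLoops k R (N - 1))) := by
  obtain ⟨M, rfl⟩ := Nat.exists_eq_add_of_le' hN
  rw [Nat.add_sub_cancel, sphereLoops_diff_eq, sphereLoops_diff_eq, Nat.cast_succ]
  exact ⟨exactLoopsEquiv _ R (by omega)⟩

end SphereLoop

theorem mainTheorem3 (k : ℕ) (R : ℝ) (hR : 0 < R) :
    (∀ N : ℕ, 1 ≤ N → Nonempty
      (↥(sphereLoops k R (N + 1) \ sphereLoops k R N) ≃ₕ
        ↥(sphereLoops k R N \ sphereLoops k R (N - 1)))) ∧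
    (∀ N : ℕ, 1 ≤ N → Nonempty
      (↥(sphereLoops k R (N + 1) \ sphereLoops k R N) ≃ₕ
        ↥(sphereLoops k R 1 \ sphereLoops k R 0))) ∧
    Nonempty
      (↥(sphereLoops k R 1 \ sphereLoops k R 0) ≃ₕ ↥(stiefelManifold 2 (k + 1))) := by
  refine ⟨SphereLoop.nonempty_sphereLoops_equiv k R, fun N hN => ?_,
    ⟨SphereLoop.stiefelEquiv k hR⟩⟩
  induction N, hN using Nat.le_induction with
  | base => exact SphereLoop.nonempty_sphereLoops_equiv k R 1 le_rfl
  | succ N hN ih =>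
    obtain ⟨f⟩ := SphereLoop.nonempty_sphereLoops_equiv k R (N + 1) (by omega)
    exact ih.map f.trans
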